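/- Let $K$ be a field. For a finite simple graph $G$, attach to each edge $e=\{u,v\}$ of $G$ the vector $\mathbf a_e\in\{0,1\}^{V(G)}$ whose entries at $u$ and $v$ are $1$ and whose other entries are $0$. The toric ideal $I_G$ is the ideal of the polynomial ring $K[e : e\in E(G)]$ generated by all binomials $\prod_e e^{s_e}-\prod_e e^{t_e}$ with $s_e,t_e\in\mathbb N$ and $\sum_e s_e\mathbf a_e=\sum_e t_e\mathbf a_e$. For a subgraph $H$ of $G$, the ideal $I_H$ is regarded as an ideal of $K[e : e\in E(G)]$ by extension along $K[e : e\in E(H)]\subseteq K[e : e\in E(G)]$. The ideal $I_G$ is called *subgraph splittable* if there are subgraphs $G_1,G_2$ of $G$ with $I_G=I_{G_1}+I_{G_2}$, $I_{G_1}\neq I_G$ and $I_{G_2}\neq I_G$. Let $n\ge 3$, and let $W_{n+1}$ be the wheel graph on $n+1$ vertices, obtained from the cycle $C_n$ of length $n$ by adding one new vertex joined to every vertex of the cycle. 1. If $n$ is even, then $I_{W_{n+1}}$ is subgraph splittable if and only if $n=4$. 2. If $n$ is odd, then $I_{W_{n+1}}$ is subgraph splittable. -/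

import Mathlib

noncomputable section

/-- The `A`-degree `∑ uᵢ aᵢ` of the monomial with exponent vector `u`, for a configuration
`A = (aᵢ)` of vectors of natural numbers. -/
def aDegree {σ V : Type*} (A : σ → V → ℕ) (u : σ →₀ ℕ) : V → ℕ :=
  u.sum fun i c => c • A i

/-- The toric ideal `I_A`: the ideal of the polynomial ring with one variable for each vector of
the configuration generated by all binomials `x^u - x^v` whose two monomials have the same
`A`-degree. -/
def toricIdeal (K : Type*) [Field K] {σ V : Type*} (A : σ → V → ℕ) :
    Ideal (MvPolynomial σ K) :=
  Ideal.span {f | ∃ u v : σ →₀ ℕ, aDegree A u = aDegree A v ∧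
    f = MvPolynomial.monomial u 1 - MvPolynomial.monomial v 1}

/-- The `0/1` vector `a_e` of an edge `e`: its entry at `v` is `1` exactly if `v` is an endpoint
of `e`. -/
def edgeVector {V : Type*} (G : SimpleGraph V) (e : G.edgeSet) : V → ℕ :=
  Set.indicator {v | v ∈ (e : Sym2 V)} 1

/-- The toric ideal `I_G` of a simple graph, in the polynomial ring whose variables are the edges
of `G`. -/
def graphToricIdeal (K : Type*) [Field K] {V : Type*} (G : SimpleGraph V) :
    Ideal (MvPolynomial G.edgeSet K) :=
  toricIdeal K (edgeVector G)

/-- The toric ideal `I_H` of a subgraph `H` of `G`, extended from the polynomial ring on the edges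
of `H` to the polynomial ring on the edges of `G`. -/
def subgraphToricIdeal (K : Type*) [Field K] {V : Type*} {G : SimpleGraph V} (H : G.Subgraph) :
    Ideal (MvPolynomial G.edgeSet K) :=
  Ideal.map (MvPolynomial.rename (R := K) H.hom.mapEdgeSet) (graphToricIdeal K H.coe)

/-- `I_G` is subgraph splittable: `I_G = I_{G₁} + I_{G₂}` for subgraphs `G₁`, `G₂` of `G` with
`I_{G₁} ≠ I_G` and `I_{G₂} ≠ I_G`. -/
def IsSubgraphSplittable (K : Type*) [Field K] {V : Type*} (G : SimpleGraph V) : Prop :=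
  ∃ G₁ G₂ : G.Subgraph,
    graphToricIdeal K G = subgraphToricIdeal K G₁ + subgraphToricIdeal K G₂ ∧
    subgraphToricIdeal K G₁ ≠ graphToricIdeal K G ∧
    subgraphToricIdeal K G₂ ≠ graphToricIdeal K G

/-- Adjacency in the wheel with rim `Fin n` and hub `none`. -/
def wheelAdj (n : ℕ) : Option (Fin n) → Option (Fin n) → Prop
  | some i, some j => (SimpleGraph.cycleGraph n).Adj i j
  | some _, none => True
  | none, some _ => True
  | none, none => False

/-- The wheel graph `W_{n+1}` on `n + 1` vertices: the cycle on the rim vertices `some i`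
together with the universal vertex `none`, joined to every rim vertex. -/
def wheelGraph (n : ℕ) : SimpleGraph (Option (Fin n)) where
  Adj := wheelAdj n
  symm := ⟨by
    rintro (_ | i) (_ | j) h
    · exact h
    · trivial
    · trivial
    · exact SimpleGraph.Adj.symm (G := SimpleGraph.cycleGraph n) h⟩
  loopless := ⟨by
    rintro (_ | i) h
    · exact h
    · exact SimpleGraph.irrefl (SimpleGraph.cycleGraph n) h⟩

end

/-! Fix a degree whose value at the rim vertex `k` is `d k`. A monomial of this degree is determined
by its multiplicities `r` on the rim edges: the spoke at `k` must supply `d k - (r (k - 1) + r k)`,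
and the hub degree fixes the sum of `r`. A fibre is thus a set of distributions of tokens on a
cycle, with capacity `d k` at each vertex. Any two of them are connected by moves of single tokens
and by steps that preserve every spoke (`rel_of_isValid`), so the corresponding binomials generate
the toric ideal (`toricIdeal_le`).

For an odd rim the second kind of step is trivial, and a token move involves only two rim edges
besides spokes. Omit the rim edge `0` from one summand and `2` from the other: only a move between
`0` and `2` lies in neither, and it factors through `1`. For rim length four, omit the spokes at `0`
and `1` instead: a move between consecutive rim edges changes two opposite spokes only, hence not
both of these, and other moves are composed of such moves.

For an even rim of length at least six, a binomial with coprime monomials that exhaust their fibre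
must be supported in one summand (`support_subset_of_mem_sup`). The two perfect matchings of the rim
put the whole rim into one summand. If a spoke is missing there, the binomials of 4-cycles and of
pairs of triangles through that spoke belong to the other summand, and together they use every edge.
-/

noncomputable section

open MvPolynomial

/-! ### Toric ideals restricted to sets of variables -/

section ToricIdeal

variable {σ V : Type*}

/-- The ideal generated by the binomials of the toric ideal `I_A` supported on the variables
in `S`. -/
def toricIdealOn (K : Type*) [Field K] (A : σ → V → ℕ) (S : Set σ) :
    Ideal (MvPolynomial σ K) :=
  Ideal.span {f | ∃ u v : σ →₀ ℕ, (u.support : Set σ) ⊆ S ∧ (v.support : Set σ) ⊆ S ∧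
    aDegree A u = aDegree A v ∧ f = monomial u 1 - monomial v 1}

theorem aDegree_add (A : σ → V → ℕ) (u v : σ →₀ ℕ) :
    aDegree A (u + v) = aDegree A u + aDegree A v := by
  unfold aDegree
  exact Finsupp.sum_add_index' (by simp) (by intros; simp [add_smul])

variable (K : Type*) [Field K] (A : σ → V → ℕ)

theorem toricIdealOn_univ : toricIdealOn K A Set.univ = toricIdeal K A := by
  simp [toricIdealOn, toricIdeal]

theorem toricIdealOn_mono {S T : Set σ} (h : S ⊆ T) :
    toricIdealOn K A S ≤ toricIdealOn K A T := by
  apply Ideal.span_mono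
  rintro f ⟨u, v, hu, hv, hd, rfl⟩
  exact ⟨u, v, hu.trans h, hv.trans h, hd, rfl⟩

theorem toricIdealOn_le (S : Set σ) : toricIdealOn K A S ≤ toricIdeal K A := by
  rw [← toricIdealOn_univ]
  exact toricIdealOn_mono K A (Set.subset_univ S)

variable {A}

/-- Two monomials of the same degree that agree outside `S` are congruent modulo
`toricIdealOn K A S`. -/
theorem monomial_sub_mem_toricIdealOn {S : Set σ} {u v : σ →₀ ℕ}
    (hd : aDegree A u = aDegree A v) (h : ∀ e, e ∉ S → u e = v e) :
    (monomial u 1 - monomial v 1 : MvPolynomial σ K) ∈ toricIdealOn K A S := by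
  -- After the greatest common divisor is cancelled, no variable on which `u` and `v` agree
  -- survives.
  set w := u ⊓ v with hw
  have hu : w + (u - w) = u := add_tsub_cancel_of_le inf_le_left
  have hv : w + (v - w) = v := add_tsub_cancel_of_le inf_le_right
  have key : (monomial u 1 - monomial v 1 : MvPolynomial σ K) =
      monomial w 1 * (monomial (u - w) 1 - monomial (v - w) 1) := by
    rw [mul_sub, monomial_mul, monomial_mul, hu, hv, one_mul]
  rw [key]
  apply Ideal.mul_mem_left
  apply Ideal.subset_span
  refine ⟨u - w, v - w, ?_, ?_, ?_, rfl⟩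
  · intro e he
    by_contra hS
    have := h e hS
    simp [hw, this] at he
  · intro e he
    by_contra hS
    have := h e hS
    simp [hw, this] at he
  · rw [← hu, ← hv, aDegree_add, aDegree_add] at hd
    exact add_left_cancel hd

variable {K}

/-- If the monomials of a binomial of degree `d` are coprime and are the only ones of degree `d`,
then the binomial lies in a sum `I_S + I_T` only if it is supported on `S` or on `T`. -/
theorem support_subset_of_mem_sup {S T : Set σ} {u v : σ →₀ ℕ} (huv : Disjoint u v) (hne : u ≠ v)
    (hfib : ∀ w, aDegree A w = aDegree A u → w = u ∨ w = v)
    (hmem : (monomial u 1 - monomial v 1 : MvPolynomial σ K) ∈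
      toricIdealOn K A S + toricIdealOn K A T) :
    ((u.support : Set σ) ⊆ S ∧ (v.support : Set σ) ⊆ S) ∨
      ((u.support : Set σ) ⊆ T ∧ (v.support : Set σ) ⊆ T) := by
  by_contra hcon
  push Not at hcon
  obtain ⟨hS, hT⟩ := hcon
  -- Replacing the factor `a` of `u` by `b` stays in the fibre. If the result is `v`, then `u - a`
  -- divides both `u` and `v`, so it is zero by coprimality; then `u = a` and `v = b` are both
  -- supported on `R`, which is excluded.
  have aux : ∀ (R : Set σ), ((u.support : Set σ) ⊆ R → ¬ (v.support : Set σ) ⊆ R) →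
      ∀ a b : σ →₀ ℕ, (a.support : Set σ) ⊆ R → (b.support : Set σ) ⊆ R →
      aDegree A a = aDegree A b → a ≤ u → a = b := by
    intro R hR a b ha hb hab hau
    have hdeg : aDegree A (u - a + b) = aDegree A u := by
      rw [aDegree_add, ← hab, ← aDegree_add, tsub_add_cancel_of_le hau]
    rcases hfib _ hdeg with h | h
    · have h2 : u - a + a = u - a + b := by rw [h, tsub_add_cancel_of_le hau]
      exact add_left_cancel h2
    · have h1 : u - a ≤ v := by rw [← h]; exact le_self_add
      have h0 : u - a = 0 := le_bot_iff.mp (huv tsub_le_self h1)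
      rw [h0, zero_add] at h
      have hua : u = a := le_antisymm (tsub_eq_zero_iff_le.mp h0) hau
      subst h hua
      exact absurd hb (hR ha)
  have key : ∀ (R : Set σ), ((u.support : Set σ) ⊆ R → ¬ (v.support : Set σ) ⊆ R) →
      ∀ f ∈ toricIdealOn K A R, coeff u f = 0 := by
    intro R hR f hf
    -- Quantifying over all multiples makes the claim stable under multiplication, as span induction
    -- requires.
    suffices h : ∀ p : MvPolynomial σ K, coeff u (p * f) = 0 by simpa using h 1
    induction hf using Submodule.span_induction with
    | mem f hf =>
      obtain ⟨a, b, ha, hb, hab, rfl⟩ := hf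
      intro p
      rw [mul_sub, coeff_sub, coeff_mul_monomial', coeff_mul_monomial']
      by_cases h1 : a ≤ u
      · rw [aux R hR a b ha hb hab h1, sub_self]
      · by_cases h2 : b ≤ u
        · rw [aux R hR b a hb ha hab.symm h2, sub_self]
        · simp [h1, h2]
    | zero => simp
    | add f g _ _ hf hg => intro p; rw [mul_add, coeff_add, hf, hg, add_zero]
    | smul a f _ hf => intro p; rw [smul_eq_mul, ← mul_assoc]; exact hf _
  obtain ⟨f, hf, g, hg, hfg⟩ := Submodule.mem_sup.mp hmem
  have h1 := congrArg (coeff u) hfg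
  classical
  rw [coeff_add, key S hS f hf, key T hT g hg] at h1
  simp [coeff_monomial, Ne.symm hne] at h1

/-- A binomial with exactly one monomial divisible by a variable outside `S` is not in
`toricIdealOn K A S`. -/
theorem toricIdealOn_ne_toricIdeal {S : Set σ} {e : σ} (he : e ∉ S) {u v : σ →₀ ℕ}
    (hd : aDegree A u = aDegree A v) (hu : u e ≠ 0) (hv : v e = 0) :
    toricIdealOn K A S ≠ toricIdeal K A := by
  classical
  intro h
  -- Evaluation at `0` for `e` and at `1` elsewhere kills every binomial avoiding `e`, but sends the
  -- given one to `-1`.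
  let φ : MvPolynomial σ K →ₐ[K] K := aeval fun x => if x = e then 0 else 1
  have hone : ∀ w : σ →₀ ℕ, w e = 0 → φ (monomial w 1) = 1 := by
    intro w hw
    rw [aeval_monomial, map_one, one_mul]
    apply Finset.prod_eq_one
    intro x hx
    have : x ≠ e := by rintro rfl; simp [hw] at hx
    simp [this]
  have hker : toricIdealOn K A S ≤ RingHom.ker φ := by
    apply Ideal.span_le.mpr
    rintro f ⟨a, b, ha, hb, -, rfl⟩
    have h1 : a e = 0 := by
      by_contra h0
      exact he (ha (by simpa using h0))
    have h2 : b e = 0 := by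
      by_contra h0
      exact he (hb (by simpa using h0))
    simp only [SetLike.mem_coe, RingHom.mem_ker, map_sub]
    rw [hone a h1, hone b h2, sub_self]
  have hmem : (monomial u 1 - monomial v 1 : MvPolynomial σ K) ∈ RingHom.ker φ := by
    apply hker
    rw [h]
    exact Ideal.subset_span ⟨u, v, hd, rfl⟩
  rw [RingHom.mem_ker, map_sub, hone v hv] at hmem
  have hzero : φ (monomial u 1) = 0 := by
    rw [aeval_monomial, map_one, one_mul]
    apply Finset.prod_eq_zero (i := e) (by simpa using hu)
    simp [hu]
  simp [hzero] at hmem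

end ToricIdeal

/-! ### From subgraphs to sets of edges -/

section Subgraph

variable {V : Type*} {G : SimpleGraph V} (H : G.Subgraph)

theorem range_hom_mapEdgeSet :
    Set.range H.hom.mapEdgeSet = {e : G.edgeSet | (e : Sym2 V) ∈ H.edgeSet} := by
  ext ⟨e, he⟩
  constructor
  · rintro ⟨⟨f, hf⟩, h⟩
    have h := congrArg Subtype.val h
    induction f using Sym2.ind with
    | h x y =>
      change s(x.1, y.1) = e at h
      subst h
      exact hf
  · intro h
    induction e using Sym2.ind with
    | h x y =>
      have h : H.Adj x y := h
      exact ⟨⟨s(⟨x, h.fst_mem⟩, ⟨y, h.snd_mem⟩), h⟩, rfl⟩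

theorem hom_mapEdgeSet_injective : Function.Injective H.hom.mapEdgeSet :=
  SimpleGraph.Hom.mapEdgeSet.injective H.hom H.hom_injective

theorem edgeVector_hom_mapEdgeSet (e : H.coe.edgeSet) (v : H.verts) :
    edgeVector G (H.hom.mapEdgeSet e) v = edgeVector H.coe e v := by
  obtain ⟨e, he⟩ := e
  induction e using Sym2.ind with
  | h x y =>
    have h : (v : V) ∈ s(x.1, y.1) ↔ v ∈ s(x, y) := by
      simp [Sym2.mem_iff, Subtype.ext_iff]
    by_cases hv : v ∈ s(x, y)
    · rw [edgeVector, edgeVector, Set.indicator_of_mem (by exact h.mpr hv),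
        Set.indicator_of_mem (by exact hv)]
      rfl
    · rw [edgeVector, edgeVector, Set.indicator_of_notMem (by exact fun h' => hv (h.mp h')),
        Set.indicator_of_notMem (by exact hv)]

theorem edgeVector_hom_mapEdgeSet_of_notMem (e : H.coe.edgeSet) {v : V} (hv : v ∉ H.verts) :
    edgeVector G (H.hom.mapEdgeSet e) v = 0 := by
  obtain ⟨e, he⟩ := e
  induction e using Sym2.ind with
  | h x y =>
    apply Set.indicator_of_notMem
    change ¬ v ∈ s(x.1, y.1)
    rw [Sym2.mem_iff]
    rintro (rfl | rfl)
    · exact hv x.2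
    · exact hv y.2

theorem aDegree_apply {σ V : Type*} (A : σ → V → ℕ) (u : σ →₀ ℕ) (v : V) :
    aDegree A u v = u.sum fun i c => c * A i v := by
  simp [aDegree, Finsupp.sum, Finset.sum_apply]

theorem aDegree_mapDomain_hom (u : H.coe.edgeSet →₀ ℕ) (v : V) :
    aDegree (edgeVector G) (u.mapDomain H.hom.mapEdgeSet) v =
      u.sum fun e c => c * edgeVector G (H.hom.mapEdgeSet e) v := by
  rw [aDegree_apply, Finsupp.sum_mapDomain_index (by simp) (by intros; ring)]

/-- Edges of `H` have degree zero at vertices outside `H`, so passing to `G` imposes no further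
condition. -/
theorem aDegree_mapDomain_hom_eq_iff (u v : H.coe.edgeSet →₀ ℕ) :
    aDegree (edgeVector G) (u.mapDomain H.hom.mapEdgeSet) =
      aDegree (edgeVector G) (v.mapDomain H.hom.mapEdgeSet) ↔
    aDegree (edgeVector H.coe) u = aDegree (edgeVector H.coe) v := by
  constructor
  · intro h
    funext x
    have := congrFun h x
    rw [aDegree_mapDomain_hom, aDegree_mapDomain_hom] at this
    simpa only [aDegree_apply, edgeVector_hom_mapEdgeSet] using this
  · intro h
    funext x
    by_cases hx : x ∈ H.verts
    · have := congrFun h ⟨x, hx⟩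
      have hx' : ∀ e, edgeVector G (H.hom.mapEdgeSet e) x = edgeVector H.coe e ⟨x, hx⟩ :=
        fun e => edgeVector_hom_mapEdgeSet H e ⟨x, hx⟩
      rw [aDegree_mapDomain_hom, aDegree_mapDomain_hom]
      simpa only [aDegree_apply, hx'] using this
    · simp only [aDegree_mapDomain_hom, edgeVector_hom_mapEdgeSet_of_notMem H _ hx, mul_zero,
        Finsupp.sum, Finset.sum_const_zero]

theorem subgraphToricIdeal_eq_toricIdealOn (K : Type*) [Field K] :
    subgraphToricIdeal K H =
      toricIdealOn K (edgeVector G) {e : G.edgeSet | (e : Sym2 V) ∈ H.edgeSet} := by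
  classical
  rw [subgraphToricIdeal, graphToricIdeal, toricIdeal, Ideal.map_span, toricIdealOn,
    ← range_hom_mapEdgeSet]
  congr 1
  ext f
  constructor
  · rintro ⟨_, ⟨u, v, hd, rfl⟩, rfl⟩
    refine ⟨u.mapDomain H.hom.mapEdgeSet, v.mapDomain H.hom.mapEdgeSet, ?_, ?_,
      (aDegree_mapDomain_hom_eq_iff H u v).mpr hd, ?_⟩
    · intro e he
      have := Finsupp.mapDomain_support he
      obtain ⟨a, -, rfl⟩ := Finset.mem_image.mp this
      exact ⟨a, rfl⟩
    · intro e he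
      have := Finsupp.mapDomain_support he
      obtain ⟨a, -, rfl⟩ := Finset.mem_image.mp this
      exact ⟨a, rfl⟩
    · simp [rename_monomial]
  · rintro ⟨u, v, hu, hv, hd, rfl⟩
    have hinj := hom_mapEdgeSet_injective H
    have hu' := Finsupp.mapDomain_comapDomain _ hinj u hu
    have hv' := Finsupp.mapDomain_comapDomain _ hinj v hv
    refine ⟨_, ⟨u.comapDomain _ hinj.injOn, v.comapDomain _ hinj.injOn, ?_, rfl⟩, ?_⟩
    · rw [← aDegree_mapDomain_hom_eq_iff, hu', hv', hd]
    · simp [rename_monomial, hu', hv']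

/-- Splittability in terms of sets of edges. -/
theorem isSubgraphSplittable_iff (K : Type*) [Field K] (G : SimpleGraph V) :
    IsSubgraphSplittable K G ↔ ∃ S T : Set G.edgeSet,
      graphToricIdeal K G = toricIdealOn K (edgeVector G) S + toricIdealOn K (edgeVector G) T ∧
      toricIdealOn K (edgeVector G) S ≠ graphToricIdeal K G ∧
      toricIdealOn K (edgeVector G) T ≠ graphToricIdeal K G := by
  constructor
  · rintro ⟨G₁, G₂, h⟩
    simp only [subgraphToricIdeal_eq_toricIdealOn] at h
    exact ⟨_, _, h⟩
  · rintro ⟨S, T, h⟩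
    have key : ∀ S : Set G.edgeSet, ∃ H : G.Subgraph,
        subgraphToricIdeal K H = toricIdealOn K (edgeVector G) S := by
      intro S
      -- Isolated vertices do not affect the ideal, so a spanning subgraph serves.
      refine ⟨(⊤ : G.Subgraph).deleteEdges (Subtype.val '' Sᶜ), ?_⟩
      rw [subgraphToricIdeal_eq_toricIdealOn]
      congr 1
      ext ⟨e, he⟩
      induction e using Sym2.ind with
      | h x y =>
        have he' : G.Adj x y := he
        simp [he']
    obtain ⟨G₁, h₁⟩ := key S
    obtain ⟨G₂, h₂⟩ := key T
    exact ⟨G₁, G₂, by rwa [h₁, h₂]⟩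

end Subgraph

/-! ### Token moves on a cycle with vertex capacities -/

section Moves

variable {Z : Type*} [CommRing Z] [DecidableEq Z]

/-- The multiplicities `r` of the rim edges `{k, k + 1}` of a wheel with rim `Z` leave a
nonnegative multiplicity for each spoke in degree `d`. -/
def IsValid (d r : Z → ℕ) : Prop := ∀ k, r (k - 1) + r k ≤ d k

/-- Move a token from position `j` to position `i`. -/
def moveToken (r : Z → ℕ) (j i : Z) : Z → ℕ :=
  fun k => r k + (if k = i then 1 else 0) - (if k = j then 1 else 0)

/-- A token added to the rim edge `i` loads the vertices `i` and `i + 1`. If such a vertex is full,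
then `r` exceeds `t` on the other rim edge there, and a token taken from that edge relieves the
vertex. One token cannot relieve two full vertices, whence the second alternative. -/
theorem exists_isValid_moveToken (h2 : (2 : Z) ≠ 0) {d r t : Z → ℕ} (hr : IsValid d r)
    (ht : IsValid d t) {i j₀ : Z} (hi : r i < t i) (hj : t j₀ < r j₀) :
    (∃ j, t j < r j ∧ IsValid d (moveToken r j i)) ∨
      (t (i - 1) < r (i - 1) ∧ t (i + 1) < r (i + 1) ∧
        r (i - 1) + r i = d i ∧ r i + r (i + 1) = d (i + 1)) := by
  have hri := hr i
  have hri' := hr (i + 1)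
  have hti := ht i
  have hti' := ht (i + 1)
  rw [add_sub_cancel_right] at hri' hti'
  have h1 : (1 : Z) ≠ 0 := fun h => h2 (by linear_combination 2 * h)
  have key : ∀ j, t j < r j → (r (i - 1) + r i < d i ∨ j = i - 1) →
      (r i + r (i + 1) < d (i + 1) ∨ j = i + 1) → IsValid d (moveToken r j i) := by
    intro j hj hl hr' k
    have hk := hr k
    have hij : i ≠ j := by rintro rfl; omega
    unfold moveToken
    by_cases hk1 : k = i
    · subst hk1
      have : k - 1 ≠ k := fun h => h1 (by linear_combination -h)
      simp only [this, if_true, if_false, hij]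
      rcases hl with hl | hl
      · split_ifs <;> omega
      · rw [if_pos hl.symm]
        rw [hl] at hj
        omega
    · by_cases hk2 : k - 1 = i
      · obtain rfl : k = i + 1 := sub_eq_iff_eq_add.mp hk2
        rw [add_sub_cancel_right] at hk ⊢
        have : i + 1 ≠ i := fun h => h1 (by linear_combination h)
        simp only [this, if_true, if_false, hij]
        rcases hr' with hr' | hr'
        · split_ifs <;> omega
        · rw [if_pos hr'.symm]
          rw [hr'] at hj
          omega
      · rw [if_neg hk1, if_neg hk2]
        omega
  by_cases hl : r (i - 1) + r i < d i
  · by_cases hr' : r i + r (i + 1) < d (i + 1)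
    · exact Or.inl ⟨j₀, hj, key j₀ hj (Or.inl hl) (Or.inl hr')⟩
    · have : t (i + 1) < r (i + 1) := by omega
      exact Or.inl ⟨i + 1, this, key _ this (Or.inl hl) (Or.inr rfl)⟩
  · have hl' : t (i - 1) < r (i - 1) := by omega
    by_cases hr' : r i + r (i + 1) < d (i + 1)
    · exact Or.inl ⟨i - 1, hl', key _ hl' (Or.inr rfl) (Or.inl hr')⟩
    · exact Or.inr ⟨hl', by omega, by omega, by omega⟩

omit [CommRing Z] in
theorem moveToken_moveToken {r : Z → ℕ} {i j : Z} (hij : i ≠ j) (hj : 0 < r j) :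
    moveToken (moveToken r j i) i j = r := by
  funext k
  unfold moveToken
  by_cases hki : k = i
  · subst hki; simp [hij]
  · by_cases hkj : k = j
    · subst hkj; simp [hki]; omega
    · simp [hki, hkj]

omit [CommRing Z] in
theorem moveToken_pos {r : Z → ℕ} {i j : Z} (hij : i ≠ j) : 0 < moveToken r j i i := by
  simp [moveToken, hij]

/-- A token can be moved by two positions through the position in between. -/
theorem exists_moveToken_between (h2 : (2 : Z) ≠ 0) {d r : Z → ℕ} {i : Z}
    (hpos : 0 < r (i + 2)) (hr : IsValid d r) (hv : IsValid d (moveToken r (i + 2) i)) :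
    ∃ s, s = moveToken r (i + 2) (i + 1) ∧ IsValid d s ∧ 0 < s (i + 1) ∧
      moveToken r (i + 2) i = moveToken s (i + 1) i := by
  have h1 : (1 : Z) ≠ 0 := fun h => h2 (by linear_combination 2 * h)
  have n1 : i + 1 ≠ i := fun h => h1 (by linear_combination h)
  have n2 : i + 2 ≠ i := fun h => h2 (by linear_combination h)
  have n3 : i + 2 ≠ i + 1 := fun h => h1 (by linear_combination h)
  refine ⟨_, rfl, ?_, moveToken_pos n3.symm, ?_⟩
  · intro k
    have hk := hr k
    have hvk := hv k
    unfold moveToken at hvk ⊢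
    by_cases hk1 : k = i + 1
    · subst hk1
      rw [add_sub_cancel_right] at hk hvk ⊢
      simp only [n1, n1.symm, n2.symm, n3.symm, if_true, if_false] at hvk ⊢
      omega
    · by_cases hk2 : k = i + 2
      · subst hk2
        have e1 : i + 2 - 1 = i + 1 := by ring
        rw [e1] at hk hvk ⊢
        simp only [n3, n3.symm, if_true, if_false] at hvk ⊢
        omega
      · have e1 : k - 1 ≠ i + 1 := fun h => hk2 (by linear_combination h)
        rw [if_neg hk1, if_neg e1]
        omega
  · funext k
    unfold moveToken
    by_cases hk0 : k = i
    · subst hk0; simp [n1.symm, n2.symm]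
    · by_cases hk1 : k = i + 1
      · subst hk1; simp [n1, n3.symm]
      · by_cases hk2 : k = i + 2
        · subst hk2; simp [n2, n3]
        · simp [hk0, hk1, hk2]

variable [Fintype Z]

-- Positivity at `j` keeps the truncated subtraction in `moveToken` exact.
omit [CommRing Z] in
theorem sum_moveToken {r : Z → ℕ} {j i : Z} (hij : i ≠ j) (hj : 0 < r j) :
    ∑ k, moveToken r j i k = ∑ k, r k := by
  have h : ∑ k, (moveToken r j i k + if k = j then 1 else 0) =
      ∑ k, (r k + if k = i then 1 else 0) := by
    apply Finset.sum_congr rfl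
    intro k _
    unfold moveToken
    by_cases hkj : k = j
    · subst hkj; simp; omega
    · simp [hkj]
  simp only [Finset.sum_add_distrib, Finset.sum_ite_eq', Finset.mem_univ, if_true] at h
  omega

-- The `ℓ¹` distance to `t` is the quantity on which `rel_of_isValid` inducts.
omit [CommRing Z] in
theorem sum_dist_moveToken_lt {r t : Z → ℕ} {j i : Z} (hi : r i < t i) (hj : t j < r j) :
    ∑ k, ((moveToken r j i k - t k) + (t k - moveToken r j i k)) <
      ∑ k, ((r k - t k) + (t k - r k)) := by
  have hij : i ≠ j := by rintro rfl; omega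
  apply Finset.sum_lt_sum
  · intro k _
    unfold moveToken
    by_cases hki : k = i
    · subst hki; simp [hij]; omega
    · by_cases hkj : k = j
      · subst hkj; simp [hki]; omega
      · simp [hki, hkj]
  · refine ⟨i, Finset.mem_univ i, ?_⟩
    simp [moveToken, hij]
    omega

/-- Valid multiplicities with the same sum are connected by moves of single tokens and by steps
that preserve the multiplicities of all spokes. -/
theorem rel_of_isValid (h2 : (2 : Z) ≠ 0)
    (hgen : ∀ P : Z → Prop, (∃ z, P z) → (∀ z, P z → P (z + 1)) → ∀ z, P z)
    {d : Z → ℕ} {R : (Z → ℕ) → (Z → ℕ) → Prop} (hsymm : ∀ r t, R r t → R t r)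
    (htrans : ∀ r s t, R r s → R s t → R r t)
    (hmove : ∀ r i j, i ≠ j → 0 < r j → IsValid d r → IsValid d (moveToken r j i) →
      R r (moveToken r j i))
    (hrim : ∀ r t, IsValid d r → IsValid d t → (∀ k, r (k - 1) + r k = t (k - 1) + t k) → R r t)
    {r t : Z → ℕ} (hr : IsValid d r) (ht : IsValid d t) (hsum : ∑ k, r k = ∑ k, t k) :
    R r t := by
  induction hN : ∑ k, ((r k - t k) + (t k - r k)) using Nat.strong_induction_on
    generalizing r t with
  | _ N ih =>
  by_cases hrt : r = t
  · subst hrt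
    exact hrim r r hr hr fun _ => rfl
  obtain ⟨i₀, hi₀⟩ : ∃ i, r i < t i := by
    by_contra! h
    exact hrt (funext fun k => ((Finset.sum_eq_sum_iff_of_le fun i _ => h i).mp hsum.symm k
      (Finset.mem_univ k)).symm)
  obtain ⟨j₀, hj₀⟩ : ∃ j, t j < r j := by
    by_contra! h
    exact hrt (funext fun k => (Finset.sum_eq_sum_iff_of_le fun i _ => h i).mp hsum k
      (Finset.mem_univ k))
  by_cases hA : ∃ i j, r i < t i ∧ t j < r j ∧ IsValid d (moveToken r j i)
  · obtain ⟨i, j, hi, hj, hv⟩ := hA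
    have hij : i ≠ j := by rintro rfl; omega
    refine htrans _ _ _ (hmove r i j hij (by omega) hr hv) ?_
    refine ih _ ?_ hv ht ?_ rfl
    · rw [← hN]; exact sum_dist_moveToken_lt hi hj
    · rw [sum_moveToken hij (by omega), hsum]
  by_cases hB : ∃ i j, t i < r i ∧ r j < t j ∧ IsValid d (moveToken t j i)
  · obtain ⟨i, j, hi, hj, hv⟩ := hB
    have hij : i ≠ j := by rintro rfl; omega
    refine htrans _ _ _ ?_ (hsymm _ _ (hmove t i j hij (by omega) ht hv))
    refine ih _ ?_ hr hv ?_ rfl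
    · rw [← hN]
      have := sum_dist_moveToken_lt hi hj
      simpa only [add_comm] using this
    · rw [sum_moveToken hij (by omega), hsum]
  -- Neither `r` nor `t` can now be moved towards the other. Deficits and surpluses therefore
  -- alternate around the whole rim, and both `r` and `t` fill every vertex, so all spokes agree.
  have hA' : ∀ i, r i < t i → t (i - 1) < r (i - 1) ∧ t (i + 1) < r (i + 1) ∧
      r (i - 1) + r i = d i ∧ r i + r (i + 1) = d (i + 1) := by
    intro i hi
    refine (exists_isValid_moveToken h2 hr ht hi hj₀).resolve_left ?_
    rintro ⟨j, hj, hv⟩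
    exact hA ⟨i, j, hi, hj, hv⟩
  have hB' : ∀ i, t i < r i → r (i - 1) < t (i - 1) ∧ r (i + 1) < t (i + 1) ∧
      t (i - 1) + t i = d i ∧ t i + t (i + 1) = d (i + 1) := by
    intro i hi
    refine (exists_isValid_moveToken h2 ht hr hi hi₀).resolve_left ?_
    rintro ⟨j, hj, hv⟩
    exact hB ⟨i, j, hi, hj, hv⟩
  have hall := hgen (fun k => r k < t k ∨ t k < r k) ⟨i₀, Or.inl hi₀⟩ (by
    rintro z (hz | hz)
    · exact Or.inr (hA' z hz).2.1
    · exact Or.inl (hB' z hz).2.1)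
  apply hrim r t hr ht
  intro k
  rcases hall k with hk | hk
  · obtain ⟨h1, -, h3, -⟩ := hA' k hk
    have := (hB' (k - 1) h1).2.2.2
    rw [sub_add_cancel] at this
    rw [h3, this]
  · obtain ⟨h1, -, h3, -⟩ := hB' k hk
    have := (hA' (k - 1) h1).2.2.2
    rw [sub_add_cancel] at this
    rw [h3, this]

end Moves

/-! ### Fibres of a wheel and the two splittings -/

section WheelConfiguration

variable {Z σ : Type*} [CommRing Z] [DecidableEq Z] [Fintype Z]

/-- `A` is the configuration of the edges of a wheel with rim `Z`: the variable `e (inl k)` is the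
rim edge `{k, k + 1}` and `e (inr k)` is the spoke at `k`. -/
structure IsWheelConfiguration (A : σ → Option Z → ℕ) (e : Z ⊕ Z ≃ σ) : Prop where
  aDegree_some : ∀ (u : σ →₀ ℕ) (k : Z), aDegree A u (some k) =
    u (e (Sum.inl (k - 1))) + u (e (Sum.inl k)) + u (e (Sum.inr k))
  aDegree_none : ∀ u : σ →₀ ℕ, aDegree A u none = ∑ k, u (e (Sum.inr k))

/-- The exponent vector with multiplicities `r` on the rim and degree `d` at the rim vertices. -/
def wheelExponent (e : Z ⊕ Z ≃ σ) (d r : Z → ℕ) : σ →₀ ℕ :=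
  (Finsupp.equivFunOnFinite.symm
    (Sum.elim r fun k => d k - (r (k - 1) + r k))).equivMapDomain e

omit [DecidableEq Z] in
@[simp]
theorem wheelExponent_inl (e : Z ⊕ Z ≃ σ) (d r : Z → ℕ) (k : Z) :
    wheelExponent e d r (e (Sum.inl k)) = r k := by
  simp [wheelExponent, Finsupp.equivMapDomain_apply]

omit [DecidableEq Z] in
@[simp]
theorem wheelExponent_inr (e : Z ⊕ Z ≃ σ) (d r : Z → ℕ) (k : Z) :
    wheelExponent e d r (e (Sum.inr k)) = d k - (r (k - 1) + r k) := by
  simp [wheelExponent, Finsupp.equivMapDomain_apply]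

omit [CommRing Z] [DecidableEq Z] [Fintype Z] in
theorem ext_of_equiv_sum (e : Z ⊕ Z ≃ σ) {u v : σ →₀ ℕ}
    (hl : ∀ k, u (e (Sum.inl k)) = v (e (Sum.inl k)))
    (hr : ∀ k, u (e (Sum.inr k)) = v (e (Sum.inr k))) : u = v := by
  ext x
  obtain ⟨k | k, rfl⟩ := e.surjective x
  · exact hl k
  · exact hr k

namespace IsWheelConfiguration

variable {A : σ → Option Z → ℕ} {e : Z ⊕ Z ≃ σ}

omit [DecidableEq Z] in
theorem isValid (h : IsWheelConfiguration A e) (u : σ →₀ ℕ) :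
    IsValid (fun k => aDegree A u (some k)) (fun k => u (e (Sum.inl k))) := by
  intro k
  simp only [h.aDegree_some]
  omega

-- Within a degree the rim multiplicities determine the spokes, so a fibre is parametrized by valid
-- `r`.
omit [DecidableEq Z] in
theorem wheelExponent_eq (h : IsWheelConfiguration A e) (u : σ →₀ ℕ) :
    wheelExponent e (fun k => aDegree A u (some k)) (fun k => u (e (Sum.inl k))) = u := by
  apply ext_of_equiv_sum e
  · intro k; simp
  · intro k
    simp only [wheelExponent_inr, h.aDegree_some]
    omega

omit [DecidableEq Z] in
theorem aDegree_wheelExponent_some (h : IsWheelConfiguration A e) {d r : Z → ℕ}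
    (hr : IsValid d r) (k : Z) : aDegree A (wheelExponent e d r) (some k) = d k := by
  rw [h.aDegree_some]
  have := hr k
  simp only [wheelExponent_inl, wheelExponent_inr]
  omega

-- Each rim edge has two rim endpoints and each spoke has one. Hence the degree determines the
-- number of rim edges.
omit [DecidableEq Z] in
theorem sum_aDegree (h : IsWheelConfiguration A e) (u : σ →₀ ℕ) :
    ∑ k, aDegree A u (some k) = 2 * ∑ k, u (e (Sum.inl k)) + aDegree A u none := by
  simp only [h.aDegree_some, h.aDegree_none, Finset.sum_add_distrib]
  have := Equiv.sum_comp (Equiv.subRight (1 : Z)) fun k => u (e (Sum.inl k))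
  simp only [Equiv.subRight_apply] at this
  omega

omit [DecidableEq Z] in
theorem sum_rim_eq (h : IsWheelConfiguration A e) {u v : σ →₀ ℕ}
    (huv : aDegree A u = aDegree A v) :
    ∑ k, u (e (Sum.inl k)) = ∑ k, v (e (Sum.inl k)) := by
  have hu := h.sum_aDegree u
  have hv := h.sum_aDegree v
  rw [huv] at hu
  omega

omit [DecidableEq Z] in
theorem aDegree_wheelExponent_eq (h : IsWheelConfiguration A e) {d r t : Z → ℕ}
    (hr : IsValid d r) (ht : IsValid d t) (hsum : ∑ k, r k = ∑ k, t k) :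
    aDegree A (wheelExponent e d r) = aDegree A (wheelExponent e d t) := by
  funext x
  rcases x with _ | k
  · have h1 := h.sum_aDegree (wheelExponent e d r)
    have h2 := h.sum_aDegree (wheelExponent e d t)
    simp only [h.aDegree_wheelExponent_some hr, wheelExponent_inl] at h1
    simp only [h.aDegree_wheelExponent_some ht, wheelExponent_inl] at h2
    omega
  · rw [h.aDegree_wheelExponent_some hr, h.aDegree_wheelExponent_some ht]

variable (K : Type*) [Field K]

/-- Congruence modulo `J` is an equivalence relation, so the connectivity of fibres reduces
generation to the two kinds of steps. -/
theorem toricIdeal_le (h : IsWheelConfiguration A e) (h2 : (2 : Z) ≠ 0)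
    (hgen : ∀ P : Z → Prop, (∃ z, P z) → (∀ z, P z → P (z + 1)) → ∀ z, P z)
    {J : Ideal (MvPolynomial σ K)}
    (hmove : ∀ d r i j, i ≠ j → 0 < r j → IsValid d r → IsValid d (moveToken r j i) →
      (monomial (wheelExponent e d r) 1 - monomial (wheelExponent e d (moveToken r j i)) 1 :
        MvPolynomial σ K) ∈ J)
    (hrim : ∀ d r t, IsValid d r → IsValid d t → (∀ k, r (k - 1) + r k = t (k - 1) + t k) →
      (∑ k, r k = ∑ k, t k) →
      (monomial (wheelExponent e d r) 1 - monomial (wheelExponent e d t) 1 :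
        MvPolynomial σ K) ∈ J) :
    toricIdeal K A ≤ J := by
  apply Ideal.span_le.mpr
  rintro f ⟨u, v, huv, rfl⟩
  rw [← h.wheelExponent_eq u, ← h.wheelExponent_eq v, huv]
  have hu := h.isValid u
  rw [huv] at hu
  refine rel_of_isValid h2 hgen (R := fun r t => (monomial (wheelExponent e _ r) 1 -
    monomial (wheelExponent e _ t) 1 : MvPolynomial σ K) ∈ J) ?_ ?_ (hmove _) ?_ hu
    (h.isValid v) (h.sum_rim_eq huv)
  · intro r t hrt
    rw [← neg_sub]
    exact J.neg_mem hrt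
  · intro r s t hrs hst
    rw [← sub_add_sub_cancel]
    exact J.add_mem hrs hst
  · intro r t hr ht hrt
    refine hrim _ r t hr ht hrt ?_
    have h1 := Equiv.sum_comp (Equiv.subRight (1 : Z)) r
    have h2 := Equiv.sum_comp (Equiv.subRight (1 : Z)) t
    simp only [Equiv.subRight_apply] at h1 h2
    have h3 : ∑ k, (r (k - 1) + r k) = ∑ k, (t (k - 1) + t k) := by simp only [hrt]
    rw [Finset.sum_add_distrib, Finset.sum_add_distrib] at h3
    omega

/-- The binomial of a token move involves only the two affected rim edges and the spokes. -/
theorem moveToken_mem (h : IsWheelConfiguration A e) {S : Set σ} {d r : Z → ℕ} {i j : Z}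
    (hij : i ≠ j) (hpos : 0 < r j) (hr : IsValid d r) (hv : IsValid d (moveToken r j i))
    (hS : ∀ x, x ∉ S → ∃ k, k ≠ i ∧ k ≠ j ∧ x = e (Sum.inl k)) :
    (monomial (wheelExponent e d r) 1 - monomial (wheelExponent e d (moveToken r j i)) 1 :
        MvPolynomial σ K) ∈ toricIdealOn K A S := by
  apply monomial_sub_mem_toricIdealOn
  · exact h.aDegree_wheelExponent_eq hr hv (sum_moveToken hij hpos).symm
  · intro x hx
    obtain ⟨k, hki, hkj, rfl⟩ := hS x hx
    simp [moveToken, hki, hkj]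

/-- For a wheel with a rim of odd length, deleting either of two rim edges at distance two
gives a splitting. -/
theorem toricIdeal_eq_add_of_odd (h : IsWheelConfiguration A e) (h2 : (2 : Z) ≠ 0)
    (hgen : ∀ P : Z → Prop, (∃ z, P z) → (∀ z, P z → P (z + 1)) → ∀ z, P z)
    {n : ℕ} (hn : Odd n) (hnZ : (n : Z) = 0) :
    toricIdeal K A = toricIdealOn K A {x | x ≠ e (Sum.inl 0)} +
      toricIdealOn K A {x | x ≠ e (Sum.inl 2)} := by
  apply le_antisymm _ (sup_le (toricIdealOn_le K A _) (toricIdealOn_le K A _))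
  set J := toricIdealOn K A {x | x ≠ e (Sum.inl 0)} + toricIdealOn K A {x | x ≠ e (Sum.inl 2)}
  have hJ0 : toricIdealOn K A {x | x ≠ e (Sum.inl 0)} ≤ J := le_sup_left
  have hJ2 : toricIdealOn K A {x | x ≠ e (Sum.inl 2)} ≤ J := le_sup_right
  have h1 : (1 : Z) ≠ 0 := fun h => h2 (by linear_combination 2 * h)
  have h12 : (1 : Z) ≠ 2 := fun h => h1 (by linear_combination -h)
  have hmove0 : ∀ d r i j, i ≠ j → 0 < r j → IsValid d r → IsValid d (moveToken r j i) →
      i ≠ 0 → j ≠ 0 →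
      (monomial (wheelExponent e d r) 1 - monomial (wheelExponent e d (moveToken r j i)) 1 :
        MvPolynomial σ K) ∈ J := by
    intro d r i j hij hj hr hv hi0 hj0
    refine hJ0 (h.moveToken_mem K hij hj hr hv ?_)
    intro x hx
    exact ⟨0, hi0.symm, hj0.symm, by simpa using hx⟩
  have hmove2 : ∀ d r i j, i ≠ j → 0 < r j → IsValid d r → IsValid d (moveToken r j i) →
      i ≠ 2 → j ≠ 2 →
      (monomial (wheelExponent e d r) 1 - monomial (wheelExponent e d (moveToken r j i)) 1 :
        MvPolynomial σ K) ∈ J := by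
    intro d r i j hij hj hr hv hi0 hj0
    refine hJ2 (h.moveToken_mem K hij hj hr hv ?_)
    intro x hx
    exact ⟨2, hi0.symm, hj0.symm, by simpa using hx⟩
  -- The move from `2` to `1` avoids the rim edge `0`, and the move from `1` to `0` avoids `2`.
  have hfar : ∀ d r, 0 < r 2 → IsValid d r → IsValid d (moveToken r 2 0) →
      (monomial (wheelExponent e d r) 1 - monomial (wheelExponent e d (moveToken r 2 0)) 1 :
        MvPolynomial σ K) ∈ J := by
    intro d r hpos hr hv
    have := exists_moveToken_between (i := (0 : Z)) h2 (d := d) (r := r)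
    simp only [zero_add] at this
    obtain ⟨s, hs, hsv, hs1, hs'⟩ := this hpos hr hv
    have m1 := hmove0 d r 1 2 h12 hpos hr (hs ▸ hsv) h1 h2
    have m2 := hmove2 d s 0 1 h1.symm hs1 hsv (hs' ▸ hv) h2.symm h12
    rw [← hs] at m1
    rw [← hs'] at m2
    rw [← sub_add_sub_cancel]
    exact J.add_mem m1 m2
  apply h.toricIdeal_le K h2 hgen
  · intro d r i j hij hj hr hv
    by_cases c0 : i ≠ 0 ∧ j ≠ 0
    · exact hmove0 d r i j hij hj hr hv c0.1 c0.2
    by_cases c2 : i ≠ 2 ∧ j ≠ 2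
    · exact hmove2 d r i j hij hj hr hv c2.1 c2.2
    have hc : (i = 0 ∧ j = 2) ∨ (i = 2 ∧ j = 0) := by
      rw [not_and_or, not_not, not_not] at c0 c2
      rcases c0 with rfl | rfl
      · exact Or.inl ⟨rfl, c2.resolve_left h2.symm⟩
      · exact Or.inr ⟨c2.resolve_right h2.symm, rfl⟩
    rcases hc with ⟨rfl, rfl⟩ | ⟨rfl, rfl⟩
    · exact hfar d r hj hr hv
    · have := hfar d (moveToken r 0 2) (moveToken_pos hij) hv
        (by rwa [moveToken_moveToken hij hj])
      rw [moveToken_moveToken hij hj] at this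
      rw [← neg_sub]
      exact J.neg_mem this
  · intro d r t _ _ hrt _
    have hr : r = t := by
      -- The difference `r - t` changes sign at each step, so after an odd turn it equals its own
      -- negative.
      have hpow : ∀ m : ℕ, (r (m : Z) : ℤ) - t (m : Z) = (-1) ^ m * ((r 0 : ℤ) - t 0) := by
        intro m
        induction m with
        | zero => simp
        | succ m ih =>
          have := hrt ((m + 1 : ℕ) : Z)
          push_cast at this
          rw [add_sub_cancel_right] at this
          push_cast
          rw [pow_succ]
          have h' : (r (m : Z) : ℤ) + r ((m : Z) + 1) = t (m : Z) + t ((m : Z) + 1) := by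
            exact_mod_cast this
          linear_combination h' - ih
      have h0 := hpow n
      rw [hnZ, hn.neg_one_pow] at h0
      have h00 : r 0 = t 0 := by omega
      funext k
      refine hgen (fun k => r k = t k) ⟨0, h00⟩ ?_ k
      intro z hz
      have := hrt (z + 1)
      rw [add_sub_cancel_right, hz] at this
      exact add_left_cancel this
    rw [hr, sub_self]
    exact J.zero_mem

/-- For a wheel with a rim of length four, deleting either of two adjacent spokes gives a
splitting. -/
theorem toricIdeal_eq_add_of_four (h : IsWheelConfiguration A e) (h2 : (2 : Z) ≠ 0)
    (hgen : ∀ P : Z → Prop, (∃ z, P z) → (∀ z, P z → P (z + 1)) → ∀ z, P z)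
    (h4 : (4 : Z) = 0) :
    toricIdeal K A = toricIdealOn K A {x | x ≠ e (Sum.inr 0)} +
      toricIdealOn K A {x | x ≠ e (Sum.inr 1)} := by
  apply le_antisymm _ (sup_le (toricIdealOn_le K A _) (toricIdealOn_le K A _))
  set J := toricIdealOn K A {x | x ≠ e (Sum.inr 0)} + toricIdealOn K A {x | x ≠ e (Sum.inr 1)}
  have hJ0 : toricIdealOn K A {x | x ≠ e (Sum.inr 0)} ≤ J := le_sup_left
  have hJ1 : toricIdealOn K A {x | x ≠ e (Sum.inr 1)} ≤ J := le_sup_right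
  have h1 : (1 : Z) ≠ 0 := fun h => h2 (by linear_combination 2 * h)
  have hZ : ∀ z : Z, z = 0 ∨ z = 1 ∨ z = 2 ∨ z = 3 := by
    apply hgen (fun z => z = 0 ∨ z = 1 ∨ z = 2 ∨ z = 3) ⟨0, Or.inl rfl⟩
    rintro z (rfl | rfl | rfl | rfl)
    · right; left; ring
    · right; right; left; ring
    · right; right; right; ring
    · left; linear_combination h4
  have hspoke : ∀ d r t, IsValid d r → IsValid d t → ∑ k, r k = ∑ k, t k →
      (r (0 - 1) + r 0 = t (0 - 1) + t 0 ∨ r (1 - 1) + r 1 = t (1 - 1) + t 1) →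
      (monomial (wheelExponent e d r) 1 - monomial (wheelExponent e d t) 1 :
        MvPolynomial σ K) ∈ J := by
    rintro d r t hr ht hrt (hs | hs)
    · refine hJ0 (monomial_sub_mem_toricIdealOn K (h.aDegree_wheelExponent_eq hr ht hrt) ?_)
      intro x hx
      obtain rfl : x = e (Sum.inr 0) := by simpa using hx
      rw [wheelExponent_inr, wheelExponent_inr, hs]
    · refine hJ1 (monomial_sub_mem_toricIdealOn K (h.aDegree_wheelExponent_eq hr ht hrt) ?_)
      intro x hx
      obtain rfl : x = e (Sum.inr 1) := by simpa using hx
      rw [wheelExponent_inr, wheelExponent_inr, hs]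
  have hadj : ∀ d r i, 0 < r (i + 1) → IsValid d r → IsValid d (moveToken r (i + 1) i) →
      (monomial (wheelExponent e d r) 1 - monomial (wheelExponent e d (moveToken r (i + 1) i)) 1 :
        MvPolynomial σ K) ∈ J := by
    intro d r i hpos hr hv
    have n1 : i + 1 ≠ i := fun h => h1 (by linear_combination h)
    apply hspoke d r _ hr hv (sum_moveToken n1.symm hpos).symm
    -- The move affects the spokes at `i` and `i + 2` only. The unaffected vertices `i + 1` and `i -
    -- 1` are opposite, so one of them is `0` or `1`.
    have up : r (i + 1 - 1) + r (i + 1) =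
        moveToken r (i + 1) i (i + 1 - 1) + moveToken r (i + 1) i (i + 1) := by
      rw [add_sub_cancel_right]
      simp only [moveToken, n1, n1.symm, if_true, if_false]
      omega
    have down : r (i - 1 - 1) + r (i - 1) =
        moveToken r (i + 1) i (i - 1 - 1) + moveToken r (i + 1) i (i - 1) := by
      have m1 : i - 1 ≠ i := fun h => h1 (by linear_combination -h)
      have m2 : i - 1 ≠ i + 1 := fun h => h2 (by linear_combination -h)
      have m3 : i - 1 - 1 ≠ i := fun h => h2 (by linear_combination -h)
      have m4 : i - 1 - 1 ≠ i + 1 := fun h => h1 (by linear_combination h4 + h)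
      simp [moveToken, m1, m2, m3, m4]
    rcases hZ i with rfl | rfl | rfl | rfl
    · right; simpa only [zero_add] using up
    · left; simpa only [sub_self] using down
    · right
      rwa [show (2 : Z) - 1 = 1 by ring] at down
    · left
      rwa [show (3 : Z) + 1 = 0 by linear_combination h4] at up ⊢
  have hadj' : ∀ d r i, 0 < r i → IsValid d r → IsValid d (moveToken r i (i + 1)) →
      (monomial (wheelExponent e d r) 1 - monomial (wheelExponent e d (moveToken r i (i + 1))) 1 :
        MvPolynomial σ K) ∈ J := by
    intro d r i hpos hr hv
    have n1 : i + 1 ≠ i := fun h => h1 (by linear_combination h)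
    have := hadj d (moveToken r i (i + 1)) i (moveToken_pos n1) hv
      (by rwa [moveToken_moveToken n1 hpos])
    rw [moveToken_moveToken n1 hpos] at this
    rw [← neg_sub]
    exact J.neg_mem this
  apply h.toricIdeal_le K h2 hgen
  · intro d r i j hij hj hr hv
    rcases hZ (j - i) with hd | hd | hd | hd
    · exact absurd (sub_eq_zero.mp hd).symm hij
    · obtain rfl : j = i + 1 := by linear_combination hd
      exact hadj d r i hj hr hv
    · obtain rfl : j = i + 2 := by linear_combination hd
      obtain ⟨s, hs, hsv, hs1, hs'⟩ := exists_moveToken_between h2 hj hr hv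
      have e2 : i + 2 = i + 1 + 1 := by ring
      have m1 := hadj d r (i + 1) (e2 ▸ hj) hr (by rw [← e2, ← hs]; exact hsv)
      have m2 := hadj d s i hs1 hsv (hs' ▸ hv)
      rw [← e2, ← hs] at m1
      rw [← hs'] at m2
      rw [← sub_add_sub_cancel]
      exact J.add_mem m1 m2
    · obtain rfl : i = j + 1 := by linear_combination -hd - h4
      exact hadj' d r j hj hr hv
  · intro d r t hr ht hrt hsum
    exact hspoke d r t hr ht hsum (Or.inl (hrt 0))

end IsWheelConfiguration

end WheelConfiguration

/-! ### Binomials that any splitting must keep in one summand -/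

section Indispensable

variable {Z σ : Type*} [CommRing Z] [DecidableEq Z] [Fintype Z]
  {A : σ → Option Z → ℕ} {e : Z ⊕ Z ≃ σ}

/-- The indicator function of the endpoints of the rim edges `{a, a + 1}` and `{b, b + 1}`. -/
def pairDegree (a b : Z) : Z → ℕ :=
  fun k => if (k = a ∨ k = a + 1) ∨ (k = b ∨ k = b + 1) then 1 else 0

omit [Fintype Z] in
theorem pairDegree_comm (a b : Z) : pairDegree a b = pairDegree b a := by
  funext k
  simp only [pairDegree]
  congr 1
  exact propext or_comm

omit [Fintype Z] in
theorem single_add_single (h1 : (1 : Z) ≠ 0) (a k : Z) :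
    (Pi.single a 1 : Z → ℕ) (k - 1) + (Pi.single a 1 : Z → ℕ) k =
      if k = a ∨ k = a + 1 then 1 else 0 := by
  by_cases hk : k = a
  · subst hk
    have : k - 1 ≠ k := fun h => h1 (by linear_combination -h)
    simp [this]
  · by_cases hk' : k = a + 1
    · subst hk'
      simp [hk]
    · have : k - 1 ≠ a := fun h => hk' (by linear_combination h)
      simp [hk, hk', this]

omit [Fintype Z] in
theorem isValid_pairDegree_left (h1 : (1 : Z) ≠ 0) (a b : Z) :
    IsValid (pairDegree a b) (Pi.single a 1) := by
  intro k
  rw [single_add_single h1, pairDegree]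
  split_ifs <;> simp_all

omit [Fintype Z] in
theorem isValid_pairDegree_right (h1 : (1 : Z) ≠ 0) (a b : Z) :
    IsValid (pairDegree a b) (Pi.single b 1) :=
  pairDegree_comm b a ▸ isValid_pairDegree_left h1 b a

theorem wheelExponent_pairDegree_inr (h1 : (1 : Z) ≠ 0) (a b k : Z) :
    wheelExponent e (pairDegree a b) (Pi.single a 1) (e (Sum.inr k)) =
      if (k = b ∨ k = b + 1) ∧ ¬ (k = a ∨ k = a + 1) then 1 else 0 := by
  rw [wheelExponent_inr, single_add_single h1, pairDegree]
  split_ifs <;> simp_all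

omit [CommRing Z] in
theorem exists_eq_single_of_sum_eq_one {r : Z → ℕ} (hr : ∑ k, r k = 1) :
    ∃ c, r = Pi.single c 1 := by
  obtain ⟨c, hc⟩ : ∃ c, r c ≠ 0 := by
    by_contra! h
    simp [h] at hr
  refine ⟨c, ?_⟩
  have h := Finset.add_sum_erase Finset.univ r (Finset.mem_univ c)
  rw [hr] at h
  have h0 : ∑ k ∈ Finset.univ.erase c, r k = 0 := by omega
  funext k
  by_cases hk : k = c
  · subst hk
    simp
    omega
  · rw [Pi.single_eq_of_ne hk]
    exact Finset.sum_eq_zero_iff.mp h0 k (by simp [hk])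

omit [DecidableEq Z] in
theorem IsWheelConfiguration.eq_wheelExponent_of_aDegree_eq (h : IsWheelConfiguration A e)
    {d r : Z → ℕ} (hr : IsValid d r) {w : σ →₀ ℕ}
    (hw : aDegree A w = aDegree A (wheelExponent e d r)) :
    ∃ t, w = wheelExponent e d t ∧ IsValid d t ∧ ∑ k, t k = ∑ k, r k := by
  have hd : (fun k => aDegree A w (some k)) = d := by
    funext k
    rw [hw, h.aDegree_wheelExponent_some hr]
  refine ⟨fun k => w (e (Sum.inl k)), ?_, ?_, ?_⟩
  · have := h.wheelExponent_eq w
    rw [hd] at this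
    exact this.symm
  · have := h.isValid w
    rwa [hd] at this
  · simpa using h.sum_rim_eq hw

variable {K : Type*} [Field K]

/-- The binomial exchanges the rim edges `a` and `b`: it comes from two triangles meeting at the hub
if they are disjoint, and from a 4-cycle through the hub if they share one vertex. By `hfib` no
third rim edge fits into the degree, so the fibre has two elements. -/
theorem IsWheelConfiguration.pair_subset (h : IsWheelConfiguration A e) (h1 : (1 : Z) ≠ 0)
    {S T : Set σ} (hST : toricIdeal K A = toricIdealOn K A S + toricIdealOn K A T) {a b : Z}
    (hab : a ≠ b)
    (hfib : ∀ c, pairDegree a b c ≠ 0 → pairDegree a b (c + 1) ≠ 0 → c = a ∨ c = b) :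
    (∃ R, (R = S ∨ R = T) ∧ e (Sum.inl a) ∈ R ∧ e (Sum.inl b) ∈ R ∧
      (∀ k, (k = a ∨ k = a + 1) → ¬ (k = b ∨ k = b + 1) → e (Sum.inr k) ∈ R) ∧
      (∀ k, (k = b ∨ k = b + 1) → ¬ (k = a ∨ k = a + 1) → e (Sum.inr k) ∈ R)) := by
  set u := wheelExponent e (pairDegree a b) (Pi.single a 1) with hu
  set v := wheelExponent e (pairDegree a b) (Pi.single b 1) with hv
  have hua := isValid_pairDegree_left h1 a b
  have hvb := isValid_pairDegree_right h1 a b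
  have hul : ∀ k, u (e (Sum.inl k)) = (Pi.single a 1 : Z → ℕ) k := by simp [hu]
  have hvl : ∀ k, v (e (Sum.inl k)) = (Pi.single b 1 : Z → ℕ) k := by simp [hv]
  have hur : ∀ k, u (e (Sum.inr k)) =
      if (k = b ∨ k = b + 1) ∧ ¬ (k = a ∨ k = a + 1) then 1 else 0 :=
    wheelExponent_pairDegree_inr h1 a b
  have hvr : ∀ k, v (e (Sum.inr k)) =
      if (k = a ∨ k = a + 1) ∧ ¬ (k = b ∨ k = b + 1) then 1 else 0 := by
    rw [hv, pairDegree_comm]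
    exact wheelExponent_pairDegree_inr h1 b a
  have hdeg : aDegree A u = aDegree A v :=
    h.aDegree_wheelExponent_eq hua hvb (by simp)
  have hdisj : Disjoint u v := by
    rw [disjoint_iff, bot_eq_zero]
    apply ext_of_equiv_sum e
    · intro k
      rw [Finsupp.inf_apply, hul, hvl]
      by_cases hk : k = a
      · subst hk; simp [hab]
      · simp [hk]
    · intro k
      rw [Finsupp.inf_apply, hur, hvr]
      split_ifs <;> simp_all
  have hne : u ≠ v := by
    intro huv
    have := DFunLike.congr_fun huv (e (Sum.inl a))
    rw [hul, hvl] at this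
    simp [hab] at this
  have hall : ∀ w, aDegree A w = aDegree A u → w = u ∨ w = v := by
    intro w hw
    obtain ⟨t, rfl, ht, hsum⟩ := h.eq_wheelExponent_of_aDegree_eq hua hw
    obtain ⟨c, rfl⟩ := exists_eq_single_of_sum_eq_one (hsum.trans (by simp))
    have hc := ht c
    have hc' := ht (c + 1)
    rw [single_add_single h1] at hc hc'
    simp only [true_or, or_true, if_true] at hc hc'
    rcases hfib c (by omega) (by omega) with rfl | rfl
    · exact Or.inl rfl
    · exact Or.inr rfl
  have hmem : (monomial u 1 - monomial v 1 : MvPolynomial σ K) ∈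
      toricIdealOn K A S + toricIdealOn K A T := by
    rw [← hST]
    exact Ideal.subset_span ⟨u, v, hdeg, rfl⟩
  obtain ⟨R, hR, huR, hvR⟩ : ∃ R, (R = S ∨ R = T) ∧ (u.support : Set σ) ⊆ R ∧
      (v.support : Set σ) ⊆ R := by
    rcases support_subset_of_mem_sup hdisj hne hall hmem with h | h
    · exact ⟨S, Or.inl rfl, h⟩
    · exact ⟨T, Or.inr rfl, h⟩
  refine ⟨R, hR, huR ?_, hvR ?_, ?_, ?_⟩
  · simp [hul]
  · simp [hvl]
  · intro k hk hk'
    apply hvR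
    simp [hvr, hk, hk']
  · intro k hk hk'
    apply huR
    simp [hur, hk, hk']

/-- Deleting an edge of a wheel makes its toric ideal smaller. -/
theorem IsWheelConfiguration.toricIdealOn_ne (h : IsWheelConfiguration A e) (h2 : (2 : Z) ≠ 0)
    (x : σ) : toricIdealOn K A {y | y ≠ x} ≠ toricIdeal K A := by
  have h1 : (1 : Z) ≠ 0 := fun h => h2 (by linear_combination 2 * h)
  obtain ⟨a | a, rfl⟩ := e.surjective x
  · have n1 : a ≠ a + 1 := fun h => h1 (by linear_combination -h)
    refine toricIdealOn_ne_toricIdeal (e := e (Sum.inl a)) (by simp)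
      (h.aDegree_wheelExponent_eq (isValid_pairDegree_left h1 a (a + 1))
        (isValid_pairDegree_right h1 a (a + 1)) (by simp)) ?_ ?_
    · simp
    · simp [n1]
  · have n1 : a ≠ a + 1 := fun h => h1 (by linear_combination -h)
    have n2 : a ≠ a + 1 + 1 := fun h => h2 (by linear_combination -h)
    -- In the 4-cycle on the rim edges `a` and `a + 1`, the spoke at `a` accompanies `a + 1` only.
    refine toricIdealOn_ne_toricIdeal (e := e (Sum.inr a)) (by simp)
      (h.aDegree_wheelExponent_eq (isValid_pairDegree_left h1 (a + 1) a)
        (isValid_pairDegree_right h1 (a + 1) a) (by simp)) ?_ ?_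
    · rw [wheelExponent_pairDegree_inr h1]
      simp [n1, n2]
    · rw [pairDegree_comm, wheelExponent_pairDegree_inr h1]
      simp

omit [DecidableEq Z] in
/-- The binomial of an even rim lies in one of the two summands of a splitting. -/
theorem IsWheelConfiguration.rim_subset (h : IsWheelConfiguration A e)
    (hgen : ∀ P : Z → Prop, (∃ z, P z) → (∀ z, P z → P (z + 1)) → ∀ z, P z)
    {alt : Z → ℕ} (halt : ∀ k, alt k + alt (k + 1) = 1)
    {S T : Set σ} (hST : toricIdeal K A = toricIdealOn K A S + toricIdealOn K A T) :
    (∀ k, e (Sum.inl k) ∈ S) ∨ (∀ k, e (Sum.inl k) ∈ T) := by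
  set alt' : Z → ℕ := fun k => alt (k + 1) with halt'
  have hpair : ∀ k, alt (k - 1) + alt k = 1 := fun k => by
    have := halt (k - 1)
    rwa [sub_add_cancel] at this
  have hpair' : ∀ k, alt' (k - 1) + alt' k = 1 := fun k => by
    have := halt k
    simpa only [halt', sub_add_cancel] using this
  have hval : IsValid (fun _ => 1) alt := fun k => (hpair k).le
  have hv' : IsValid (fun _ => 1) alt' := fun k => (hpair' k).le
  have hdeg := h.aDegree_wheelExponent_eq hval hv' (Equiv.sum_comp (Equiv.addRight (1 : Z)) alt).symm
  set u := wheelExponent e (fun _ => 1) alt with hu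
  set v := wheelExponent e (fun _ => 1) alt' with hv
  have hur : ∀ k, u (e (Sum.inr k)) = 0 := by simp [hu, hpair]
  have hvr : ∀ k, v (e (Sum.inr k)) = 0 := by simp [hv, hpair']
  have hdisj : Disjoint u v := by
    rw [disjoint_iff, bot_eq_zero]
    apply ext_of_equiv_sum e
    · intro k
      have := halt k
      rw [Finsupp.inf_apply, hu, hv, wheelExponent_inl, wheelExponent_inl]
      change min (alt k) (alt (k + 1)) = 0
      omega
    · intro k
      rw [Finsupp.inf_apply, hur, hvr]
      simp
  have hne : u ≠ v := by
    intro huv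
    have := DFunLike.congr_fun huv (e (Sum.inl 0))
    rw [hu, hv, wheelExponent_inl, wheelExponent_inl] at this
    have h0 := halt 0
    change alt 0 = alt (0 + 1) at this
    omega
  -- Hub degree zero excludes spokes, so `w` is a perfect matching of the rim and is fixed by its
  -- value at one edge.
  have hall : ∀ w, aDegree A w = aDegree A u → w = u ∨ w = v := by
    intro w hw
    have hhub := congrFun hw none
    rw [h.aDegree_none, h.aDegree_none] at hhub
    simp only [hur, Finset.sum_const_zero, Finset.sum_eq_zero_iff, Finset.mem_univ,
      forall_const] at hhub
    have hstep : ∀ k, w (e (Sum.inl k)) + w (e (Sum.inl (k + 1))) = 1 := by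
      intro k
      have := congrFun hw (some (k + 1))
      rw [h.aDegree_wheelExponent_some hval, h.aDegree_some, hhub, add_sub_cancel_right] at this
      simpa using this
    by_cases h0 : w (e (Sum.inl 0)) = alt 0
    · left
      apply ext_of_equiv_sum e
      · rw [hu]
        simp only [wheelExponent_inl]
        refine hgen (fun k => w (e (Sum.inl k)) = alt k) ⟨0, h0⟩ ?_
        intro z hz
        have := hstep z
        have := halt z
        omega
      · intro k; rw [hhub, hur]
    · right
      apply ext_of_equiv_sum e
      · rw [hv]
        simp only [wheelExponent_inl]
        refine hgen (fun k => w (e (Sum.inl k)) = alt' k) ⟨0, ?_⟩ ?_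
        · change _ = alt (0 + 1)
          have := hstep 0
          have := halt 0
          omega
        · intro z hz
          change _ = alt (z + 1 + 1)
          change _ = alt (z + 1) at hz
          have := hstep z
          have := halt (z + 1)
          omega
      · intro k; rw [hhub, hvr]
  have hmem : (monomial u 1 - monomial v 1 : MvPolynomial σ K) ∈
      toricIdealOn K A S + toricIdealOn K A T := by
    rw [← hST]
    exact Ideal.subset_span ⟨u, v, hdeg, rfl⟩
  have key : ∀ R : Set σ, (u.support : Set σ) ⊆ R → (v.support : Set σ) ⊆ R →
      ∀ k, e (Sum.inl k) ∈ R := by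
    intro R huR hvR k
    have hk := halt k
    by_cases h0 : alt k = 0
    · apply hvR
      have : alt (k + 1) ≠ 0 := by omega
      simpa [hv, halt'] using this
    · apply huR
      simpa [hu] using h0
  rcases support_subset_of_mem_sup hdisj hne hall hmem with h | h
  · exact Or.inl (key S h.1 h.2)
  · exact Or.inr (key T h.1 h.2)

end Indispensable

/-! ### Even rims of length at least six -/

section Even

variable {Z σ : Type*} [CommRing Z] [DecidableEq Z] [Fintype Z]
  {A : σ → Option Z → ℕ} {e : Z ⊕ Z ≃ σ} {K : Type*} [Field K]

omit [Fintype Z] in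
/-- Two rim edges that are disjoint and not joined by a rim edge are the only rim edges with both
endpoints among their endpoints. -/
theorem pairDegree_of_far (h1 : (1 : Z) ≠ 0) (h2 : (2 : Z) ≠ 0) {a b : Z}
    (hab1 : b ≠ a + 1) (hab2 : b ≠ a + 2) (hba1 : a ≠ b + 1) (hba2 : a ≠ b + 2) (c : Z)
    (hc : pairDegree a b c ≠ 0) (hc' : pairDegree a b (c + 1) ≠ 0) : c = a ∨ c = b := by
  have e2 : ∀ x : Z, x + 1 + 1 = x + 2 := fun x => by ring
  have hc : (c = a ∨ c = a + 1) ∨ (c = b ∨ c = b + 1) := by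
    simpa only [pairDegree, ne_eq, ite_eq_right_iff, one_ne_zero, imp_false, not_not] using hc
  have hc' : (c + 1 = a ∨ c + 1 = a + 1) ∨ (c + 1 = b ∨ c + 1 = b + 1) := by
    simpa only [pairDegree, ne_eq, ite_eq_right_iff, one_ne_zero, imp_false, not_not] using hc'
  rcases hc with (rfl | rfl) | (rfl | rfl)
  · exact Or.inl rfl
  · rw [e2] at hc'
    rcases hc' with (h | h) | (h | h)
    · exact absurd (by linear_combination h) h2
    · exact absurd (by linear_combination h) h1
    · exact absurd h.symm hab2
    · exact absurd (by linear_combination -h) hab1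
  · exact Or.inr rfl
  · rw [e2] at hc'
    rcases hc' with (h | h) | (h | h)
    · exact absurd h.symm hba2
    · exact absurd (by linear_combination -h) hba1
    · exact absurd (by linear_combination h) h2
    · exact absurd (by linear_combination h) h1

-- The condition `3 ≠ 0` prevents the rim edge `a + 2` from closing a triangle with `a` and `a + 1`.
omit [Fintype Z] in
theorem pairDegree_of_adjacent (h1 : (1 : Z) ≠ 0) (h2 : (2 : Z) ≠ 0) (h3 : (3 : Z) ≠ 0) {a b : Z}
    (hab : b = a + 1) (c : Z)
    (hc : pairDegree a b c ≠ 0) (hc' : pairDegree a b (c + 1) ≠ 0) : c = a ∨ c = b := by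
  subst hab
  have hc : (c = a ∨ c = a + 1) ∨ (c = a + 1 ∨ c = a + 1 + 1) := by
    simpa only [pairDegree, ne_eq, ite_eq_right_iff, one_ne_zero, imp_false, not_not] using hc
  have hc' : (c + 1 = a ∨ c + 1 = a + 1) ∨ (c + 1 = a + 1 ∨ c + 1 = a + 1 + 1) := by
    simpa only [pairDegree, ne_eq, ite_eq_right_iff, one_ne_zero, imp_false, not_not] using hc'
  rcases hc with (rfl | rfl) | (rfl | rfl)
  · exact Or.inl rfl
  · exact Or.inr rfl
  · exact Or.inr rfl
  · rcases hc' with (h | h) | (h | h)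
    · exact absurd (by linear_combination h) h3
    · exact absurd (by linear_combination h) h2
    · exact absurd (by linear_combination h) h2
    · exact absurd (by linear_combination h) h1

/-- If a summand of a splitting contains the rim of a wheel of rim length at least six but not the
spoke at `p`, then the other one contains all edges. -/
theorem IsWheelConfiguration.eq_univ_of_notMem (h : IsWheelConfiguration A e)
    (h2 : (2 : Z) ≠ 0) (h3 : (3 : Z) ≠ 0) (h4 : (4 : Z) ≠ 0) (h5 : (5 : Z) ≠ 0)
    {S T : Set σ} (hST : toricIdeal K A = toricIdealOn K A S + toricIdealOn K A T)
    {p : Z} (hp : e (Sum.inr p) ∉ S) : T = Set.univ := by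
  have h1 : (1 : Z) ≠ 0 := fun h => h2 (by linear_combination 2 * h)
  -- A binomial of a pair that involves the spoke at `p` cannot belong to `S`, so all its variables
  -- lie in `T`.
  have pair : ∀ a b : Z, a ≠ b →
      (∀ c, pairDegree a b c ≠ 0 → pairDegree a b (c + 1) ≠ 0 → c = a ∨ c = b) →
      ((p = a ∨ p = a + 1) ∧ ¬ (p = b ∨ p = b + 1) ∨
        (p = b ∨ p = b + 1) ∧ ¬ (p = a ∨ p = a + 1)) →
      e (Sum.inl a) ∈ T ∧ e (Sum.inl b) ∈ T ∧
      (∀ k, (k = a ∨ k = a + 1) → ¬ (k = b ∨ k = b + 1) → e (Sum.inr k) ∈ T) ∧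
      (∀ k, (k = b ∨ k = b + 1) → ¬ (k = a ∨ k = a + 1) → e (Sum.inr k) ∈ T) := by
    intro a b hab hc hpab
    obtain ⟨R, rfl | rfl, hR⟩ := h.pair_subset h1 hST hab hc
    · rcases hpab with hpab | hpab
      · exact absurd (hR.2.2.1 p hpab.1 hpab.2) hp
      · exact absurd (hR.2.2.2 p hpab.1 hpab.2) hp
    · exact hR
  have far : ∀ a b : Z, b ≠ a → b ≠ a + 1 → b ≠ a + 2 → b + 1 ≠ a → b + 2 ≠ a →
      (p = a ∨ p = a + 1) → e (Sum.inl a) ∈ T ∧ e (Sum.inl b) ∈ T ∧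
      e (Sum.inr a) ∈ T ∧ e (Sum.inr (a + 1)) ∈ T ∧ e (Sum.inr b) ∈ T ∧
        e (Sum.inr (b + 1)) ∈ T := by
    intro a b n0 n1 n2 m1 m2 hpa
    have n3 : b + 1 ≠ a + 1 := fun h => n0 (add_right_cancel h)
    have hpb : ¬ (p = b ∨ p = b + 1) := by
      rintro (rfl | rfl)
      · rcases hpa with hpa | hpa
        · exact n0 hpa
        · exact n1 hpa
      · rcases hpa with hpa | hpa
        · exact m1 hpa
        · exact n3 hpa
    obtain ⟨q1, q2, q3, q4⟩ := pair a b n0.symm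
      (pairDegree_of_far h1 h2 n1 n2 m1.symm m2.symm) (Or.inl ⟨hpa, hpb⟩)
    refine ⟨q1, q2, q3 _ (Or.inl rfl) ?_, q3 _ (Or.inr rfl) ?_, q4 _ (Or.inl rfl) ?_,
      q4 _ (Or.inr rfl) ?_⟩
    · rintro (h | h)
      · exact n0 h.symm
      · exact m1 h.symm
    · rintro (h | h)
      · exact n1 h.symm
      · exact n3 h.symm
    · rintro (h | h)
      · exact n0 h
      · exact n1 h
    · rintro (h | h)
      · exact m1 h
      · exact n3 h
  have square : ∀ a : Z, (p = a ∨ p = a + 2) → e (Sum.inl a) ∈ T ∧ e (Sum.inl (a + 1)) ∈ T ∧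
      e (Sum.inr a) ∈ T ∧ e (Sum.inr (a + 2)) ∈ T := by
    intro a hpa
    have e2 : a + 1 + 1 = a + 2 := by ring
    have n1 : ¬ (a = a + 1 ∨ a = a + 1 + 1) := by
      rintro (h | h)
      · exact h1 (by linear_combination -h)
      · exact h2 (by linear_combination -h)
    have n2 : ¬ (a + 2 = a ∨ a + 2 = a + 1) := by
      rintro (h | h)
      · exact h2 (by linear_combination h)
      · exact h1 (by linear_combination h)
    obtain ⟨q1, q2, q3, q4⟩ := pair a (a + 1) (fun h => h1 (by linear_combination -h))
      (pairDegree_of_adjacent h1 h2 h3 rfl) (by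
        rcases hpa with rfl | rfl
        · exact Or.inl ⟨Or.inl rfl, n1⟩
        · exact Or.inr ⟨Or.inr e2.symm, n2⟩)
    exact ⟨q1, q2, q3 a (Or.inl rfl) n1, q4 (a + 2) (Or.inr e2.symm) n2⟩
  -- These four binomials cover the edges indexed near `p`; for any other `c`, the triangles on the
  -- rim edges `p` and `c` suffice.
  have sq1 := square p (Or.inl rfl)
  have sq2 := square (p - 2) (Or.inr (by ring))
  have f1 := far p (p + 3) (fun h => h3 (by linear_combination h))
    (fun h => h2 (by linear_combination h)) (fun h => h1 (by linear_combination h))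
    (fun h => h4 (by linear_combination h)) (fun h => h5 (by linear_combination h)) (Or.inl rfl)
  have f2 := far (p - 1) (p + 2) (fun h => h3 (by linear_combination h))
    (fun h => h2 (by linear_combination h)) (fun h => h1 (by linear_combination h))
    (fun h => h4 (by linear_combination h)) (fun h => h5 (by linear_combination h))
    (Or.inr (by ring))
  have all : ∀ c, e (Sum.inl c) ∈ T ∧ e (Sum.inr c) ∈ T := by
    intro c
    by_cases c0 : c = p
    · subst c0; exact ⟨sq1.1, sq1.2.2.1⟩
    by_cases c1 : c = p + 1
    · subst c1; exact ⟨sq1.2.1, f1.2.2.2.1⟩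
    by_cases c2 : c = p + 2
    · subst c2; exact ⟨f2.2.1, sq1.2.2.2⟩
    by_cases c3 : c + 1 = p
    · obtain rfl : c = p - 1 := by linear_combination c3
      exact ⟨f2.1, f2.2.2.1⟩
    by_cases c4 : c + 2 = p
    · obtain rfl : c = p - 2 := by linear_combination c4
      exact ⟨sq2.1, sq2.2.2.1⟩
    have f := far p c c0 c1 c2 c3 c4 (Or.inl rfl)
    exact ⟨f.2.1, f.2.2.2.2.1⟩
  ext x
  obtain ⟨c | c, rfl⟩ := e.surjective x
  · simp [(all c).1]
  · simp [(all c).2]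

/-- The toric ideal of a wheel of even rim length at least six has no splitting. -/
theorem IsWheelConfiguration.not_splittable_of_even (h : IsWheelConfiguration A e)
    (hgen : ∀ P : Z → Prop, (∃ z, P z) → (∀ z, P z → P (z + 1)) → ∀ z, P z)
    {alt : Z → ℕ} (halt : ∀ k, alt k + alt (k + 1) = 1)
    (h2 : (2 : Z) ≠ 0) (h3 : (3 : Z) ≠ 0) (h4 : (4 : Z) ≠ 0) (h5 : (5 : Z) ≠ 0)
    {S T : Set σ} (hST : toricIdeal K A = toricIdealOn K A S + toricIdealOn K A T)
    (hS : toricIdealOn K A S ≠ toricIdeal K A) : toricIdealOn K A T = toricIdeal K A := by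
  have hne : ∀ {R : Set σ}, toricIdealOn K A R ≠ toricIdeal K A → ∃ x, x ∉ R := by
    intro R hR
    by_contra! hall
    exact hR (by rw [Set.eq_univ_of_forall hall, toricIdealOn_univ])
  -- Stated for arbitrary `S` and `T`, since either summand may be the one containing the rim.
  have key : ∀ {S T : Set σ}, toricIdeal K A = toricIdealOn K A S + toricIdealOn K A T →
      toricIdealOn K A S ≠ toricIdeal K A → (∀ k, e (Sum.inl k) ∈ S) →
      toricIdealOn K A T = toricIdeal K A := by
    intro S T hST hS hrim
    obtain ⟨x, hx⟩ := hne hS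
    obtain ⟨k | k, rfl⟩ := e.surjective x
    · exact absurd (hrim k) hx
    · rw [h.eq_univ_of_notMem h2 h3 h4 h5 hST hx, toricIdealOn_univ]
  rcases h.rim_subset hgen halt hST with hrim | hrim
  · exact key hST hS hrim
  · by_contra hT
    exact hS (key (hST.trans (add_comm _ _)) hT hrim)

end Even

/-! ### The wheel graph with rim indexed modulo its length -/

section WheelGraph

open SimpleGraph Fin.CommRing

theorem wheelGraph_adj_some_none {n : ℕ} (i : Fin n) : (wheelGraph n).Adj (some i) none := trivial

theorem wheelGraph_adj_some_some {m : ℕ} (i j : Fin (m + 3)) :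
    (wheelGraph (m + 3)).Adj (some i) (some j) ↔ j = i + 1 ∨ i = j + 1 := by
  change (cycleGraph (m + 3)).Adj i j ↔ _
  rw [cycleGraph_adj]
  grind

/-- The edges of a wheel: the rim edges `{k, k + 1}` and the spokes. -/
def wheelEdge (m : ℕ) : Fin (m + 3) ⊕ Fin (m + 3) → (wheelGraph (m + 3)).edgeSet
  | Sum.inl k => ⟨s(some k, some (k + 1)), (wheelGraph_adj_some_some _ _).mpr (Or.inl rfl)⟩
  | Sum.inr k => ⟨s(some k, none), wheelGraph_adj_some_none k⟩

theorem fin_natCast_ne_zero {n a : ℕ} [NeZero n] (ha : 0 < a) (han : a < n) :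
    ((a : ℕ) : Fin n) ≠ 0 := by
  rw [Ne, Fin.natCast_eq_zero]
  exact Nat.not_dvd_of_pos_of_lt ha han

theorem fin_induction_succ {n : ℕ} [NeZero n] (P : Fin n → Prop) (h0 : ∃ z, P z)
    (hs : ∀ z, P z → P (z + 1)) (z : Fin n) : P z := by
  obtain ⟨z₀, h0⟩ := h0
  have key : ∀ j : ℕ, P (z₀ + (j : Fin n)) := by
    intro j
    induction j with
    | zero => simpa using h0
    | succ j ih =>
      rw [Nat.cast_succ, ← add_assoc]
      exact hs _ ih
  have := key (z - z₀).val
  rwa [Fin.cast_val_eq_self, add_sub_cancel] at this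

theorem fin_two_ne_zero (m : ℕ) : (2 : Fin (m + 3)) ≠ 0 :=
  fin_natCast_ne_zero (a := 2) (by omega) (by omega)

theorem fin_add_two_ne {m : ℕ} (i : Fin (m + 3)) : i + 1 + 1 ≠ i :=
  fun h => fin_two_ne_zero m (by linear_combination h)

theorem wheelEdge_bijective (m : ℕ) : Function.Bijective (wheelEdge m) := by
  constructor
  · rintro (i | i) (j | j) h <;> have h := congrArg Subtype.val h <;>
      simp only [wheelEdge, Sym2.eq_iff, Option.some.injEq, reduceCtorEq, and_false, false_and,
        or_false, and_true] at h
    · rcases h with h | ⟨rfl, h⟩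
      · rw [h.1]
      · exact absurd h (fin_add_two_ne j)
    · rw [h]
  · rintro ⟨x, hx⟩
    induction x using Sym2.ind with
    | h x y =>
      rcases x with _ | i <;> rcases y with _ | j
      · exact absurd (show (wheelGraph (m + 3)).Adj none none from hx) (SimpleGraph.irrefl _)
      · exact ⟨Sum.inr j, Subtype.ext Sym2.eq_swap⟩
      · exact ⟨Sum.inr i, rfl⟩
      · rcases (wheelGraph_adj_some_some i j).mp hx with rfl | rfl
        · exact ⟨Sum.inl i, rfl⟩
        · exact ⟨Sum.inl j, Subtype.ext Sym2.eq_swap⟩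

theorem edgeVector_wheelEdge_inl (m : ℕ) (k j : Fin (m + 3)) :
    edgeVector (wheelGraph (m + 3)) (wheelEdge m (Sum.inl k)) (some j) =
      (if k = j - 1 then 1 else 0) + (if k = j then 1 else 0) := by
  have h1 : (1 : Fin (m + 3)) ≠ 0 := fin_natCast_ne_zero (a := 1) (by omega) (by omega)
  have hmem : (some j ∈ ((wheelEdge m (Sum.inl k) : (wheelGraph (m + 3)).edgeSet) :
      Sym2 (Option (Fin (m + 3))))) ↔ k = j ∨ k = j - 1 := by
    simp [wheelEdge, eq_sub_iff_add_eq, eq_comm]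
  rw [edgeVector, Set.indicator_apply]
  simp only [Set.mem_ofPred_eq, hmem, Pi.one_apply]
  by_cases hk : k = j
  · have hk' : k ≠ j - 1 := fun h => h1 (by linear_combination h - hk)
    rw [if_pos (Or.inl hk), if_neg hk', if_pos hk, zero_add]
  · simp [hk]

theorem isWheelConfiguration_wheelGraph (m : ℕ) :
    IsWheelConfiguration (edgeVector (wheelGraph (m + 3)))
      (Equiv.ofBijective _ (wheelEdge_bijective m)) := by
  let _ : Fintype (wheelGraph (m + 3)).edgeSet :=
    Fintype.ofEquiv _ (Equiv.ofBijective _ (wheelEdge_bijective m))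
  have hsum : ∀ (u : (wheelGraph (m + 3)).edgeSet →₀ ℕ) v,
      aDegree (edgeVector (wheelGraph (m + 3))) u v =
        ∑ k, u (wheelEdge m (Sum.inl k)) *
          edgeVector (wheelGraph (m + 3)) (wheelEdge m (Sum.inl k)) v +
        ∑ k, u (wheelEdge m (Sum.inr k)) *
          edgeVector (wheelGraph (m + 3)) (wheelEdge m (Sum.inr k)) v := by
    intro u v
    rw [aDegree_apply, Finsupp.sum_fintype _ _ (by simp),
      ← Equiv.sum_comp (Equiv.ofBijective _ (wheelEdge_bijective m)), Fintype.sum_sum_type]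
    rfl
  constructor
  · intro u j
    rw [hsum]
    simp only [edgeVector_wheelEdge_inl, mul_add, Finset.sum_add_distrib]
    simp [edgeVector, Set.indicator_apply, wheelEdge]
  · intro u
    rw [hsum]
    simp [edgeVector, wheelEdge]

/-- The parity of the representative alternates also across the wrap-around, because the last index
is odd and its successor is `0`. -/
theorem alternating_fin {m : ℕ} (hm : Even (m + 3)) (k : Fin (m + 3)) :
    (if Even k.val then 1 else 0) + (if Even (k + 1).val then 1 else 0) = 1 := by
  rw [Fin.val_add_one]
  by_cases hk : k = Fin.last (m + 2)
  · have : ¬ Even (m + 2) := by rw [Nat.even_add_one] at hm; exact hm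
    subst hk
    simp [this]
  · rw [if_neg hk]
    by_cases h : Even k.val <;> simp [h, Nat.even_add_one]

theorem isSubgraphSplittable_wheelGraph (K : Type*) [Field K] (m : ℕ) :
    (Even (m + 3) → (IsSubgraphSplittable K (wheelGraph (m + 3)) ↔ m + 3 = 4)) ∧
    (Odd (m + 3) → IsSubgraphSplittable K (wheelGraph (m + 3))) := by
  have h := isWheelConfiguration_wheelGraph m
  have h2 := fin_two_ne_zero m
  simp only [isSubgraphSplittable_iff]
  refine ⟨fun heven => ⟨?_, ?_⟩, fun hodd => ?_⟩
  · rintro ⟨S, T, hST, hS, hT⟩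
    by_contra hne
    -- Length at least six makes `3`, `4` and `5` nonzero modulo the rim length.
    have hm : 6 ≤ m + 3 := by
      obtain ⟨a, ha⟩ := heven
      omega
    exact hT (h.not_splittable_of_even fin_induction_succ (alternating_fin heven) h2
      (fin_natCast_ne_zero (a := 3) (by omega) (by omega))
      (fin_natCast_ne_zero (a := 4) (by omega) (by omega))
      (fin_natCast_ne_zero (a := 5) (by omega) (by omega)) hST hS)
  · intro hm
    obtain rfl : m = 1 := by omega
    exact ⟨_, _, h.toricIdeal_eq_add_of_four K h2 fin_induction_succ rfl,
      h.toricIdealOn_ne h2 _, h.toricIdealOn_ne h2 _⟩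
  · exact ⟨_, _, h.toricIdeal_eq_add_of_odd K h2 fin_induction_succ hodd
      (Fin.natCast_eq_zero.mpr dvd_rfl), h.toricIdealOn_ne h2 _, h.toricIdealOn_ne h2 _⟩

end WheelGraph

end

theorem mainTheorem4 (K : Type*) [Field K] (n : ℕ) (hn : 3 ≤ n) :
    (Even n → (IsSubgraphSplittable K (wheelGraph n) ↔ n = 4)) ∧
    (Odd n → IsSubgraphSplittable K (wheelGraph n)) := by
  obtain ⟨m, rfl⟩ := Nat.exists_eq_add_of_le' hn
  exact isSubgraphSplittable_wheelGraph K m
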